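/- All graphs are finite, simple and undirected. For a graph $G$ let $q(G)$ denote its signless Laplacian spectral radius, i.e. the largest eigenvalue of $\mathbf D(G)+\mathbf A(G)$, where $\mathbf D(G)$ is the diagonal degree matrix and $\mathbf A(G)$ the adjacency matrix of $G$. A graph $G$ is $k$-factor-critical if $G-S$ has a perfect matching for every $k$-element set $S\subseteq V(G)$. Write $\cup$ for disjoint union, $\vee$ for join, $K_m$ for the complete graph of order $m$, and $mK_1$ for the edgeless graph of order $m$. Theorem. Let $G$ be a graph of order $n$ with minimum degree $\delta$, let $k$ be an integer with $0\le k<\delta$ and $k\equiv n \pmod 2$, and suppose that $n\ge 9\delta-2k+12$. Put $$H=K_\delta\vee\bigl((\delta-k+1)K_1\cup K_{n-2\delta+k-1}\bigr).$$ If $q(G)\ge q(H)$, then $G$ is $k$-factor-critical unless $G\cong H$, in which case $G$ is not $k$-factor-critical. Moreover, $q(H)$ is equal to the largest real root of $g(x)=0$, where $$\begin{aligned} g(x)={}&x^3-(3n-\delta+2k-6)x^2\\ &+\bigl(2n^2+(\delta+2k-8)n-4\delta^2+4(k-1)\delta-4k+8\bigr)x\\ &-2\delta^3+(4n+4k-10)\delta^2-\bigl(2n^2+(4k-10)n+2k^2-10k+12\bigr)\delta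 . \end{aligned}$$ -/

import Mathlib

noncomputable section

/-- The join `G ∨ H`: the disjoint union of `G` and `H` together with all edges between the
vertices of `G` and the vertices of `H`. -/
def graphJoin {V W : Type*} (G : SimpleGraph V) (H : SimpleGraph W) : SimpleGraph (V ⊕ W) :=
  (G ⊕g H) ⊔ completeBipartiteGraph V W

open Classical in
/-- The signless Laplacian matrix `Q(G) = D(G) + A(G)` over the reals. -/
def signlessLaplacian {V : Type*} [Fintype V] (G : SimpleGraph V) : Matrix V V ℝ :=
  G.degMatrix ℝ + G.adjMatrix ℝ

open Classical in
/-- The signless Laplacian spectral radius `q(G)`: the largest eigenvalue of `Q(G)`.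
(It is attained for every graph with at least one vertex, see `isGreatest_signlessRadius`.) -/
def signlessRadius {V : Type*} [Fintype V] (G : SimpleGraph V) : ℝ :=
  sSup {μ : ℝ | Module.End.HasEigenvalue (Matrix.toLin' (signlessLaplacian G)) μ}

open Classical in
/-- The supremum in the definition of `signlessRadius` is a maximum. -/
theorem isGreatest_signlessRadius {V : Type*} [Fintype V] [Nonempty V] (G : SimpleGraph V) :
    IsGreatest {μ : ℝ | Module.End.HasEigenvalue (Matrix.toLin' (signlessLaplacian G)) μ}
      (signlessRadius G) := by
  have hH : (signlessLaplacian G).IsHermitian :=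
    (G.isHermitian_degMatrix ℝ).add (G.isHermitian_adjMatrix ℝ)
  have hset : {μ : ℝ | Module.End.HasEigenvalue (Matrix.toLin' (signlessLaplacian G)) μ}
      = Set.range hH.eigenvalues := by
    rw [← hH.spectrum_real_eq_range_eigenvalues]
    ext μ
    rw [Set.mem_ofPred_eq, Module.End.hasEigenvalue_iff_mem_spectrum, Matrix.spectrum_toLin']
  unfold signlessRadius
  rw [hset]
  have hfin : (Set.range hH.eigenvalues).Finite := Set.finite_range _
  exact ⟨(Set.range_nonempty _).csSup_mem hfin, fun x hx => le_csSup hfin.bddAbove hx⟩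

/-- `G` is `k`-factor-critical: `G - S` has a perfect matching for every `k`-subset `S` of the
vertex set. -/
def IsFactorCritical {V : Type*} (G : SimpleGraph V) (k : ℕ) : Prop :=
  ∀ S : Finset V, S.card = k →
    ∃ M : (G.induce {v : V | v ∉ S}).Subgraph, M.IsPerfectMatching

/-- The graph `K_δ ∨ ((δ - k + 1) K_1 ∪ K_{n - 2δ + k - 1})`. The subtractions of natural numbers
do not truncate when `k ≤ δ` and `2 * δ + 1 ≤ n + k`. -/
def extremalGraph (n δ k : ℕ) :
    SimpleGraph (Fin δ ⊕ (Fin (δ - k + 1) ⊕ Fin (n + k - 2 * δ - 1))) :=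
  graphJoin (⊤ : SimpleGraph (Fin δ))
    (SimpleGraph.sum (⊥ : SimpleGraph (Fin (δ - k + 1)))
      (⊤ : SimpleGraph (Fin (n + k - 2 * δ - 1))))

/-- The cubic `g`, with real parameters `n`, `δ`, `k`. -/
def extremalCubic (n δ k x : ℝ) : ℝ :=
  x ^ 3 - (3 * n - δ + 2 * k - 6) * x ^ 2
    + (2 * n ^ 2 + (δ + 2 * k - 8) * n - 4 * δ ^ 2 + 4 * (k - 1) * δ - 4 * k + 8) * x
    - 2 * δ ^ 3 + (4 * n + 4 * k - 10) * δ ^ 2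
    - (2 * n ^ 2 + (4 * k - 10) * n + 2 * k ^ 2 - 10 * k + 12) * δ

end

/-! Write `N = n - δ + k - 1`, the order of the largest clique of `H`, `l = q(H)` and `θ = l - 2 (N
- 1)`. Since `2 (N - 1) = q(K_N)`, one has `θ > 0`.

If `G` is not `k`-factor-critical, Tutte's theorem and parity give a set `S` of size `s ≥ k` whose
removal leaves `s - k + 2` nonempty, mutually nonadjacent classes of sizes `m i`. A test vector that
is 1 on `S` and constant on each class shows `q(G) < l` as soon as `s * ∑ m i / (l - s + 2 - 2 * m
i) < l - (n + s - 2)` and the denominators are positive (`signlessRadius_lt_of_partition`). As `y /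
(c - 2 y)` is convex, the sum is largest when all classes but one have the least possible size `p`.
This leaves a polynomial inequality in `θ`, to be compared with the cubic equation satisfied by `l`.

For `s > δ` (with `p = 1`) and for `s < δ` (with `p = δ - s + 1`, forced by the minimum degree) the
inequality is strict, contradicting `q(G) ≥ l`. For `s = δ` and `p = 1` it is an equality, so the
strict form of convexity forces the class sizes of `H`. Then `G` is a spanning subgraph of `H`, and
strict monotonicity of `q` (`eq_of_le_signlessRadius`) gives `G ≅ H`. -/

/-! ### The cubic, and convexity of `y / (c - 2 y)` -/

/-- With `θ = x - 2 (N - 1)` and `d = δ - k + 1` the cubic is `(x - δ) θ (θ + N) - d x (θ + δ)`, the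
shape in which every later comparison uses it. -/
theorem extremalCubic_eq (n δ k x : ℝ) :
    extremalCubic n δ k x =
      (x - δ) * (x - 2 * (n - δ + k - 2)) * (x - 2 * (n - δ + k - 2) + (n - δ + k - 1))
        - (δ - k + 1) * x * (x - 2 * (n - δ + k - 2) + δ) := by
  unfold extremalCubic
  ring

/-- The function `y ↦ y / (c - 2 y)` lies below its chord over `[p, M]`. -/
theorem div_sub_two_mul_le_chord {p M c y : ℝ} (hc : 0 ≤ c) (hM : 0 < c - 2 * M)
    (hpy : p ≤ y) (hyM : y ≤ M) :
    y / (c - 2 * y) ≤ p / (c - 2 * p) + c / ((c - 2 * p) * (c - 2 * M)) * (y - p) := by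
  have h1 : 0 < c - 2 * y := by linarith
  have h2 : 0 < c - 2 * p := by linarith
  -- The gap between chord and function in closed form; it vanishes exactly at the endpoints when `c
  -- > 0`.
  have key : p / (c - 2 * p) + c / ((c - 2 * p) * (c - 2 * M)) * (y - p) - y / (c - 2 * y)
      = 2 * c * (y - p) * (M - y) / ((c - 2 * p) * (c - 2 * M) * (c - 2 * y)) := by
    have e1 := h1.ne'
    have e2 := h2.ne'
    have e3 := hM.ne'
    rw [eq_div_iff (by positivity)]
    have f1 : y / (c - 2 * y) * (c - 2 * y) = y := div_mul_cancel₀ _ e1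
    have f2 : p / (c - 2 * p) * (c - 2 * p) = p := div_mul_cancel₀ _ e2
    have f3 : c / ((c - 2 * p) * (c - 2 * M)) * ((c - 2 * p) * (c - 2 * M)) = c :=
      div_mul_cancel₀ _ (mul_ne_zero e2 e3)
    linear_combination (c - 2 * M) * (c - 2 * y) * f2 + (y - p) * (c - 2 * y) * f3
      - (c - 2 * p) * (c - 2 * M) * f1
  have : 0 ≤ 2 * c * (y - p) * (M - y) / ((c - 2 * p) * (c - 2 * M) * (c - 2 * y)) := by
    have := sub_nonneg.2 hpy
    have := sub_nonneg.2 hyM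
    positivity
  linarith

theorem div_sub_two_mul_lt_chord {p M c y : ℝ} (hc : 0 < c) (hM : 0 < c - 2 * M)
    (hpy : p < y) (hyM : y < M) :
    y / (c - 2 * y) < p / (c - 2 * p) + c / ((c - 2 * p) * (c - 2 * M)) * (y - p) := by
  have h1 : 0 < c - 2 * y := by linarith
  have h2 : 0 < c - 2 * p := by linarith
  have key : p / (c - 2 * p) + c / ((c - 2 * p) * (c - 2 * M)) * (y - p) - y / (c - 2 * y)
      = 2 * c * (y - p) * (M - y) / ((c - 2 * p) * (c - 2 * M) * (c - 2 * y)) := by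
    have e1 := h1.ne'
    have e2 := h2.ne'
    have e3 := hM.ne'
    rw [eq_div_iff (by positivity)]
    have f1 : y / (c - 2 * y) * (c - 2 * y) = y := div_mul_cancel₀ _ e1
    have f2 : p / (c - 2 * p) * (c - 2 * p) = p := div_mul_cancel₀ _ e2
    have f3 : c / ((c - 2 * p) * (c - 2 * M)) * ((c - 2 * p) * (c - 2 * M)) = c :=
      div_mul_cancel₀ _ (mul_ne_zero e2 e3)
    linear_combination (c - 2 * M) * (c - 2 * y) * f2 + (y - p) * (c - 2 * y) * f3
      - (c - 2 * p) * (c - 2 * M) * f1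
  have : 0 < 2 * c * (y - p) * (M - y) / ((c - 2 * p) * (c - 2 * M) * (c - 2 * y)) := by
    have := sub_pos.2 hpy
    have := sub_pos.2 hyM
    positivity
  linarith

theorem le_of_sum_eq_extreme {ι : Type*} [Fintype ι] {y : ι → ℝ} {p M : ℝ}
    (hp : ∀ i, p ≤ y i) (hsum : ∑ i, y i = (Fintype.card ι - 1) * p + M) (i : ι) : y i ≤ M := by
  have h : ∑ j, (y j - p) = M - p := by
    rw [Finset.sum_sub_distrib, hsum]
    simp
    ring
  have := Finset.single_le_sum (f := fun j => y j - p) (fun j _ => sub_nonneg.2 (hp j))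
    (Finset.mem_univ i)
  linarith

/-- The chord is affine, so its sum depends only on `∑ y i` and may be evaluated at the extreme
point with one entry `M` and all others `p`. -/
theorem sum_chord {ι : Type*} [Fintype ι] {y : ι → ℝ} {p M c : ℝ}
    (hpM : 0 < c - 2 * p) (hM : 0 < c - 2 * M)
    (hsum : ∑ i, y i = (Fintype.card ι - 1) * p + M) :
    ∑ i, (p / (c - 2 * p) + c / ((c - 2 * p) * (c - 2 * M)) * (y i - p))
      = (Fintype.card ι - 1) * (p / (c - 2 * p)) + M / (c - 2 * M) := by
  rw [Finset.sum_add_distrib, ← Finset.mul_sum, Finset.sum_sub_distrib, hsum]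
  simp only [Finset.sum_const, Finset.card_univ, nsmul_eq_mul]
  have f2 : p / (c - 2 * p) * (c - 2 * p) = p := div_mul_cancel₀ _ hpM.ne'
  have f3 : M / (c - 2 * M) * (c - 2 * M) = M := div_mul_cancel₀ _ hM.ne'
  have f4 : c / ((c - 2 * p) * (c - 2 * M)) * ((c - 2 * p) * (c - 2 * M)) = c :=
    div_mul_cancel₀ _ (mul_ne_zero hpM.ne' hM.ne')
  refine mul_right_cancel₀ (mul_ne_zero hpM.ne' hM.ne') ?_
  linear_combination (c - 2 * M) * f2 + (M - p) * f4 - (c - 2 * p) * f3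

theorem sum_div_sub_two_mul_le {ι : Type*} [Fintype ι] {y : ι → ℝ} {p M c : ℝ}
    (hc : 0 ≤ c) (hpM : 0 < c - 2 * p) (hM : 0 < c - 2 * M) (hp : ∀ i, p ≤ y i)
    (hsum : ∑ i, y i = (Fintype.card ι - 1) * p + M) :
    ∑ i, y i / (c - 2 * y i) ≤ (Fintype.card ι - 1) * (p / (c - 2 * p)) + M / (c - 2 * M) := by
  rw [← sum_chord hpM hM hsum]
  exact Finset.sum_le_sum fun i _ =>
    div_sub_two_mul_le_chord hc hM (hp i) (le_of_sum_eq_extreme hp hsum i)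

theorem sum_div_sub_two_mul_lt {ι : Type*} [Fintype ι] {y : ι → ℝ} {p M c : ℝ}
    (hc : 0 < c) (hpM : 0 < c - 2 * p) (hM : 0 < c - 2 * M) (hp : ∀ i, p ≤ y i)
    (hsum : ∑ i, y i = (Fintype.card ι - 1) * p + M) (hlt : ∃ i, p < y i ∧ y i < M) :
    ∑ i, y i / (c - 2 * y i) < (Fintype.card ι - 1) * (p / (c - 2 * p)) + M / (c - 2 * M) := by
  rw [← sum_chord hpM hM hsum]
  obtain ⟨i, hi1, hi2⟩ := hlt
  exact Finset.sum_lt_sum (fun i _ =>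
    div_sub_two_mul_le_chord hc.le hM (hp i) (le_of_sum_eq_extreme hp hsum i))
    ⟨i, Finset.mem_univ i, div_sub_two_mul_lt_chord hc hM hi1 hi2⟩

/-! ### Polynomial inequalities for the extreme configurations -/

/-- The row of the quotient matrix belonging to the join part, with denominators cleared. -/
theorem quotient_row_identity {s m A θ N : ℝ} (hA : A ≠ 0) (hB : θ + s ≠ 0) :
    (θ + 2 * (N - 1)) - (m + N + s - 2) - s * (m / A + (N - s) / (θ + s))
      = (θ * (θ + N) * A - m * (A + s) * (θ + s)) / (A * (θ + s)) := by
  field_simp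
  ring

theorem quotient_row_lt {s m A θ N : ℝ} (hA : 0 < A) (hB : 0 < θ + s)
    (h : m * (A + s) * (θ + s) < θ * (θ + N) * A) :
    s * (m / A + (N - s) / (θ + s)) < (θ + 2 * (N - 1)) - (m + N + s - 2) := by
  have := quotient_row_identity (m := m) (N := N) hA.ne' hB.ne'
  have h2 : 0 < (θ * (θ + N) * A - m * (A + s) * (θ + s)) / (A * (θ + s)) :=
    div_pos (sub_pos.2 h) (mul_pos hA hB)
  linarith

theorem quotient_row_eq {s m A θ N : ℝ} (hA : A ≠ 0) (hB : θ + s ≠ 0)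
    (h : θ * (θ + N) * A = m * (A + s) * (θ + s)) :
    s * (m / A + (N - s) / (θ + s)) = (θ + 2 * (N - 1)) - (m + N + s - 2) := by
  have := quotient_row_identity (m := m) (N := N) hA hB
  rw [h, sub_self, zero_div] at this
  linarith

/-- Comparison with the graph `K_s ∨ ((s - k + 1) K_1 ∪ K)` for `s = δ + j > δ`. -/
theorem quotient_ineq_large {N δ d j θ : ℝ} (hθ : 0 < θ) (hδ : 1 ≤ δ) (hd : 2 ≤ d)
    (hdδ : d ≤ δ + 1) (hN : 7 * δ + d + 10 ≤ N) (hj : 1 ≤ j) (hjN : 2 * j + δ + 1 ≤ N)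
    (h : (θ + 2 * (N - 1) - δ) * θ * (θ + N) = d * (θ + 2 * (N - 1)) * (θ + δ)) :
    (d + j) * (θ + 2 * (N - 1)) * (θ + 2 * j + (δ + j))
      < (θ + 2 * j) * (θ + 2 * j + (N - j)) * (θ + 2 * (N - 1) - (δ + j)) := by
  have key : δ * (3 * θ + 2 * N + 2 * j) + (θ + 2 * j) * (θ + j + N)
      < (θ + 2 * (N - 1)) * (2 * θ + 2 * N - j - δ - 3 * d) := by
    have h1 : 2 * j ≤ N - δ - 1 := by linarith
    nlinarith [mul_pos hθ (by linarith : 0 < j), mul_pos hθ hθ]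
  -- At `j = 0` the two sides agree by `h`. Subtracting `h` therefore leaves a multiple of `j`,
  -- whose cofactor is positive by `key`.
  have : 0 < j * ((θ + 2 * (N - 1)) * (2 * θ + 2 * N - j - δ - 3 * d)
      - (δ * (3 * θ + 2 * N + 2 * j) + (θ + 2 * j) * (θ + j + N))) :=
    mul_pos (by linarith) (by linarith)
  linarith

/-- The case `s = k`, `v = δ - s`: two classes, the smaller of size `d = v + 1`. After
multiplication by `l - (s + v) > 0`, the cubic equation eliminates `θ (θ + N)`. -/
theorem quotient_ineq_boundary {N s v d θ : ℝ} (hθ : 0 < θ) (hs : 0 ≤ s) (hv : 1 ≤ v)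
    (hd : 0 < d) (hN : 7 * (s + v) + 11 ≤ N)
    (h : (θ + 2 * (N - 1) - (s + v)) * θ * (θ + N) = d * (θ + 2 * (N - 1)) * (θ + (s + v))) :
    d * ((θ + 2 * (N - 1)) - s - 2 * v + s) * (θ + s)
      < θ * (θ + N) * ((θ + 2 * (N - 1)) - s - 2 * v) := by
  set l := θ + 2 * (N - 1) with hl
  have hl2 : 2 * (s + v) < l := by linarith
  have hpos : 0 < l - (s + v) := by linarith
  refine lt_of_mul_lt_mul_right ?_ hpos.le
  have e : θ * (θ + N) * (l - s - 2 * v) * (l - (s + v))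
      = d * l * (θ + (s + v)) * (l - s - 2 * v) := by linear_combination (l - s - 2 * v) * h
  rw [e]
  have h1 : (l - 2 * v) * (l - (s + v)) ≤ l * (l - s - 2 * v) := by nlinarith
  have h2 : 0 < l * (l - s - 2 * v) := mul_pos (by linarith) (by linarith)
  calc d * (l - s - 2 * v + s) * (θ + s) * (l - (s + v))
      = d * (((l - 2 * v) * (l - (s + v))) * (θ + s)) := by ring
    _ ≤ d * ((l * (l - s - 2 * v)) * (θ + s)) := by gcongr
    _ < d * ((l * (l - s - 2 * v)) * (θ + (s + v))) := by
        gcongr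
        linarith
    _ = _ := by ring

/-- The case `k < s < δ`, with `u = s - k` and `v = δ - s`. There is enough room to dispense with
the cubic: `A ≥ 12 s` lets `A + s` be replaced by `13 / 12 * A`, and the factor `A` cancels. -/
theorem quotient_ineq_small {N s u v θ : ℝ} (hθ : 0 < θ) (hu : 1 ≤ u) (hv : 1 ≤ v)
    (hs : u ≤ s) (hN : 7 * (s + v) + 11 ≤ N) (hw : u * v + (s + v) + 1 ≤ N) :
    (u + 1) * (v + 1) * ((θ + 2 * (N - 1)) - s - 2 * v + s) * (θ + 2 * (u * v) + s)
      < (θ + 2 * (u * v)) * (θ + 2 * (u * v) + (N - u * v)) *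
        ((θ + 2 * (N - 1)) - s - 2 * v) := by
  set w := u * v with hw'
  have hw1 : 1 ≤ w := by nlinarith
  have hd1 : (u + 1) * (v + 1) ≤ 2 * w + 2 := by nlinarith
  have hd2 : (u + 1) * (v + 1) ≤ w + (s + v) + 1 := by nlinarith
  set m := (u + 1) * (v + 1) with hm
  have hm0 : 0 < m := by positivity
  set A := (θ + 2 * (N - 1)) - s - 2 * v with hA
  have hA1 : 12 * s ≤ A := by linarith
  have hA0 : 0 < A := by linarith
  have h1 : 13 / 12 * m * (2 * w + s) < 2 * w * (N + w) := by
    obtain ⟨d, hd⟩ : ∃ d, m = w + d := ⟨m - w, by ring⟩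
    rw [hd] at hd1 hd2 ⊢
    have a1 : d * s ≤ (w + 2) * s := mul_le_mul_of_nonneg_right (by linarith) (by linarith)
    have a2 : (w + 2) * s ≤ 3 * w * s := mul_le_mul_of_nonneg_right (by linarith) (by linarith)
    have a3 : w * d ≤ w * (s + v + 1) := mul_le_mul_of_nonneg_left (by linarith) (by linarith)
    have a4 : w * w ≤ w * N := mul_le_mul_of_nonneg_left (by linarith) (by linarith)
    have a5 : w * (7 * (s + v) + 11) ≤ w * N := mul_le_mul_of_nonneg_left hN (by linarith)
    have a6 : 0 < w * v := by positivity
    have a7 : 0 < w * s := mul_pos (by linarith) (by linarith)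
    nlinarith
  -- `h1` is the case `θ = 0`; the remaining terms are `θ ^ 2` and `θ` times `N + 3 * w - 13 / 12 *
  -- m`.
  have h2 : 13 / 12 * m * (θ + 2 * w + s) < (θ + 2 * w) * (θ + 2 * w + (N - w)) := by
    have : 13 / 12 * m ≤ 13 / 12 * (w + (s + v) + 1) := by linarith
    have b : 13 / 12 * m ≤ N + 3 * w := by linarith
    nlinarith [mul_le_mul_of_nonneg_left b hθ.le, mul_pos hθ hθ]
  calc m * (A + s) * (θ + 2 * w + s) ≤ m * (13 / 12 * A) * (θ + 2 * w + s) := by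
        have : 0 ≤ θ + 2 * w + s := by linarith
        gcongr
        linarith
    _ = 13 / 12 * m * (θ + 2 * w + s) * A := by ring
    _ < _ := mul_lt_mul_of_pos_right h2 hA0

/-! ### Bounds on the spectral radius from positive test vectors -/

open Classical in
theorem signlessLaplacian_mulVec {V : Type*} [Fintype V] (G : SimpleGraph V) (y : V → ℝ) (v : V) :
    (signlessLaplacian G).mulVec y v = ∑ w, if G.Adj v w then y v + y w else 0 := by
  unfold signlessLaplacian
  rw [Matrix.add_mulVec, Pi.add_apply, SimpleGraph.adjMatrix_mulVec_apply,
    SimpleGraph.degMatrix_mulVec_apply, ← Finset.sum_filter, Finset.sum_add_distrib,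
    ← SimpleGraph.neighborFinset_eq_filter]
  simp

open Classical in
theorem exists_eigenvector_signlessRadius {V : Type*} [Fintype V] [Nonempty V]
    (G : SimpleGraph V) : ∃ y : V → ℝ, y ≠ 0 ∧
      ∀ v, ∑ w, (if G.Adj v w then y v + y w else 0) = signlessRadius G * y v := by
  obtain ⟨y, hy⟩ := (isGreatest_signlessRadius G).1.exists_hasEigenvector
  refine ⟨y, hy.2, fun v => ?_⟩
  rw [← signlessLaplacian_mulVec, ← Matrix.toLin'_apply, hy.apply_eq_smul]
  simp

open Classical in
theorem le_signlessRadius_of_eigenvector {V : Type*} [Fintype V] [Nonempty V]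
    (G : SimpleGraph V) {l : ℝ} {y : V → ℝ} (hy : y ≠ 0)
    (h : ∀ v, ∑ w, (if G.Adj v w then y v + y w else 0) = l * y v) : l ≤ signlessRadius G := by
  refine (isGreatest_signlessRadius G).2 ?_
  refine Module.End.hasEigenvalue_of_hasEigenvector (x := y) ⟨?_, hy⟩
  rw [Module.End.mem_eigenspace_iff, Matrix.toLin'_apply]
  ext v
  rw [signlessLaplacian_mulVec, h]
  simp

/-- A weighted maximum principle: the ratio `|y| / x` of an eigenvector `y` to a positive
vector `x` attains its maximum at some vertex. -/
theorem exists_max_ratio {V : Type*} [Fintype V] [Nonempty V] {x y : V → ℝ}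
    (hx : ∀ v, 0 < x v) (hy : y ≠ 0) :
    ∃ R : ℝ, 0 < R ∧ (∀ w, |y w| ≤ R * x w) ∧ ∃ v, |y v| = R * x v := by
  obtain ⟨v, -, hv⟩ := Finset.exists_max_image Finset.univ (fun v => |y v| / x v)
    Finset.univ_nonempty
  have hle : ∀ w, |y w| ≤ |y v| / x v * x w := fun w =>
    (div_le_iff₀ (hx w)).1 (hv w (Finset.mem_univ w))
  refine ⟨|y v| / x v, ?_, hle, v, (div_mul_cancel₀ _ (hx v).ne').symm⟩
  obtain ⟨w, hw⟩ := Function.ne_iff.1 hy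
  by_contra hneg
  have := mul_nonpos_of_nonpos_of_nonneg (not_lt.1 hneg) (hx w).le
  exact hw (abs_eq_zero.1 (le_antisymm ((hle w).trans this) (abs_nonneg _)))

open Classical in
theorem abs_eigenvalue_mul_le {V : Type*} [Fintype V] (G : SimpleGraph V) {y : V → ℝ} {μ : ℝ} {v : V}
    (h : ∑ w, (if G.Adj v w then y v + y w else 0) = μ * y v) :
    |μ * y v| ≤ ∑ w, if G.Adj v w then |y v| + |y w| else 0 := by
  rw [← h]
  refine (Finset.abs_sum_le_sum_abs _ _).trans (Finset.sum_le_sum fun w _ => ?_)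
  split_ifs
  · exact abs_add_le _ _
  · simp

-- At a vertex `v` where `|y| / x` attains its maximum `R`, the row of `|y|` is at most `R` times
-- the row of `x`, hence less than `l * |y v|`.
open Classical in
theorem signlessRadius_lt_of_lt {V : Type*} [Fintype V] [Nonempty V] (G : SimpleGraph V)
    {l : ℝ} {x : V → ℝ} (hx : ∀ v, 0 < x v)
    (h : ∀ v, ∑ w, (if G.Adj v w then x v + x w else 0) < l * x v) : signlessRadius G < l := by
  obtain ⟨y, hy0, hy⟩ := exists_eigenvector_signlessRadius G
  obtain ⟨R, hR, hle, v, hv⟩ := exists_max_ratio hx hy0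
  have h1 := abs_eigenvalue_mul_le G (hy v)
  have h2 : ∑ w, (if G.Adj v w then |y v| + |y w| else 0)
      ≤ R * ∑ w, (if G.Adj v w then x v + x w else 0) := by
    rw [Finset.mul_sum]
    refine Finset.sum_le_sum fun w _ => ?_
    split_ifs
    · rw [mul_add]
      exact add_le_add hv.le (hle w)
    · simp
  have h3 := mul_lt_mul_of_pos_left (h v) hR
  have h4 : |signlessRadius G| * (R * x v) < l * (R * x v) := by
    rw [← hv, ← abs_mul, hv]
    calc _ ≤ _ := h1
      _ ≤ _ := h2
      _ < _ := h3
      _ = _ := by ring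
  exact (le_abs_self _).trans_lt (lt_of_mul_lt_mul_right h4 (mul_pos hR (hx v)).le)

/-- Strict monotonicity: if `H` has a universal vertex and a positive eigenvector with eigenvalue
`l`, then no proper spanning subgraph of `H` has signless Laplacian spectral radius at least `l`. -/
theorem eq_of_le_signlessRadius {V : Type*} [Fintype V] [Nonempty V] {G H : SimpleGraph V}
    (hGH : G ≤ H) {u : V} (hu : ∀ w, w ≠ u → H.Adj u w) {l : ℝ} {x : V → ℝ} (hx : ∀ v, 0 < x v)
    (h : open Classical in ∀ v, ∑ w, (if H.Adj v w then x v + x w else 0) = l * x v)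
    (hl : l ≤ signlessRadius G) : G = H := by
  classical
  obtain ⟨y, hy0, hy⟩ := exists_eigenvector_signlessRadius G
  obtain ⟨R, hR, hle, v₀, hv₀⟩ := exists_max_ratio hx hy0
  -- At a vertex of maximal ratio all estimates are equalities, so every `H`-edge there lies in `G`
  -- and the neighbour has maximal ratio too. The universal vertex `u` carries this to all vertices.
  have step : ∀ v, |y v| = R * x v → ∀ w, H.Adj v w → G.Adj v w ∧ |y w| = R * x w := by
    intro v hv
    have h1 := abs_eigenvalue_mul_le G (hy v)
    have h2 : ∀ w ∈ Finset.univ, (if G.Adj v w then |y v| + |y w| else 0)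
        ≤ (if H.Adj v w then R * (x v + x w) else 0) := by
      intro w _
      have := mul_pos hR (add_pos (hx v) (hx w))
      by_cases hG : G.Adj v w
      · rw [if_pos hG, if_pos (hGH hG), mul_add]
        exact add_le_add hv.le (hle w)
      · rw [if_neg hG]
        split_ifs
        · exact this.le
        · exact le_rfl
    have h3 : ∑ w, (if H.Adj v w then R * (x v + x w) else 0) = l * |y v| := by
      rw [hv]
      have := congrArg (R * ·) (h v)
      simp only [Finset.mul_sum, mul_ite, mul_zero] at this
      rw [this]
      ring
    have h4 : l * |y v| ≤ |signlessRadius G * y v| := by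
      rw [abs_mul]
      exact mul_le_mul_of_nonneg_right (hl.trans (le_abs_self _)) (abs_nonneg _)
    have h5 := (Finset.sum_eq_sum_iff_of_le h2).1
      (le_antisymm (Finset.sum_le_sum h2) (h3.le.trans (h4.trans h1)))
    intro w hw
    have h6 := h5 w (Finset.mem_univ w)
    have h7 := mul_pos hR (add_pos (hx v) (hx w))
    rw [if_pos hw] at h6
    by_cases hG : G.Adj v w
    · rw [if_pos hG, hv, mul_add] at h6
      exact ⟨hG, by linarith⟩
    · rw [if_neg hG] at h6
      linarith
  have hyu : |y u| = R * x u := by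
    by_cases e : v₀ = u
    · rwa [← e]
    · exact (step v₀ hv₀ u (hu v₀ e).symm).2
  have hall : ∀ w, |y w| = R * x w := by
    intro w
    by_cases e : w = u
    · rwa [e]
    · exact (step u hyu w (hu w e)).2
  exact le_antisymm hGH fun v w hvw => (step v (hall v) w hvw).1

open Classical in
theorem signlessRadius_le_of_eigenvector {V : Type*} [Fintype V] [Nonempty V] (G : SimpleGraph V)
    {l : ℝ} {x : V → ℝ} (hx : ∀ v, 0 < x v)
    (h : ∀ v, ∑ w, (if G.Adj v w then x v + x w else 0) = l * x v) : signlessRadius G ≤ l := by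
  refine le_of_forall_gt_imp_ge_of_dense fun m hm => (signlessRadius_lt_of_lt G hx fun v => ?_).le
  rw [h]
  exact mul_lt_mul_of_pos_right hm (hx v)

theorem signlessRadius_le_of_iso {V W : Type*} [Fintype V] [Fintype W] [Nonempty V]
    {G : SimpleGraph V} {H : SimpleGraph W} (e : G ≃g H) :
    signlessRadius G ≤ signlessRadius H := by
  classical
  have : Nonempty W := ⟨e (Classical.arbitrary V)⟩
  obtain ⟨y, hy0, hy⟩ := exists_eigenvector_signlessRadius G
  refine le_signlessRadius_of_eigenvector H (y := y ∘ e.symm) ?_ fun w => ?_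
  · obtain ⟨v, hv⟩ := Function.ne_iff.1 hy0
    exact Function.ne_iff.2 ⟨e v, by simpa using hv⟩
  · rw [Function.comp_apply, ← hy (e.symm w)]
    refine (Fintype.sum_equiv e.toEquiv _ _ fun v => ?_).symm
    have : G.Adj (e.symm w) v ↔ H.Adj w (e v) := by
      rw [← e.map_adj_iff, RelIso.apply_symm_apply]
    simp [this]

/-- If deleting `S` splits the other vertices into mutually nonadjacent classes of sizes `m i`, the
signless Laplacian spectral radius is controlled by the quotient matrix of the corresponding
partition. -/
theorem signlessRadius_lt_of_partition {V ι : Type*} [Fintype V] [Nonempty V] [DecidableEq V]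
    [Fintype ι] [DecidableEq ι] (G : SimpleGraph V) (S : Finset V) (c : V → ι)
    (hc : ∀ v w, v ∉ S → w ∉ S → G.Adj v w → c v = c w) {l : ℝ}
    (hpos : ∀ i, 0 < l - S.card + 2 - 2 * ((Sᶜ.filter (c · = i)).card : ℝ))
    (hS : (S.card : ℝ) * ∑ i, ((Sᶜ.filter (c · = i)).card : ℝ) /
        (l - S.card + 2 - 2 * ((Sᶜ.filter (c · = i)).card : ℝ))
      < l - (Fintype.card V + S.card - 2)) :
    signlessRadius G < l := by
  classical
  set m : ι → ℝ := fun i => ((Sᶜ.filter (c · = i)).card : ℝ) with hm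
  set s : ℝ := (S.card : ℝ) with hs
  have hs0 : 0 ≤ s := Nat.cast_nonneg _
  set F : ℝ := ∑ i, m i / (l - s + 2 - 2 * m i) with hF
  have hF0 : 0 ≤ F := Finset.sum_nonneg fun i _ =>
    div_nonneg (Nat.cast_nonneg _) (hpos i).le
  -- The exact class weight `s / (l - s + 2 - 2 * m i)` would only give equality in the class rows,
  -- and vanishes if `S` is empty. The slack in `hS` pays for `s + ε`, making those rows strict and
  -- the weights positive.
  obtain ⟨ε, hε, hεF⟩ : ∃ ε : ℝ, 0 < ε ∧ (s + ε) * F < l - (Fintype.card V + s - 2) := by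
    refine ⟨(l - (Fintype.card V + s - 2) - s * F) / (F + 1), div_pos (sub_pos.2 hS) (by linarith),
      ?_⟩
    set T := l - (Fintype.card V + s - 2) - s * F with hT
    have hT0 : 0 < T := sub_pos.2 hS
    have : T / (F + 1) * F < T := by
      rw [div_mul_eq_mul_div, div_lt_iff₀ (by linarith)]
      nlinarith
    linarith
  set z : ι → ℝ := fun i => (s + ε) / (l - s + 2 - 2 * m i) with hz
  have hz0 : ∀ i, 0 < z i := fun i => div_pos (by linarith) (hpos i)
  set x : V → ℝ := fun v => if v ∈ S then 1 else z (c v) with hx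
  have hx0 : ∀ v, 0 < x v := by
    intro v
    simp only [hx]
    split_ifs
    · exact one_pos
    · exact hz0 _
  have hxS : ∀ v ∈ S, x v = 1 := fun v hv => if_pos hv
  have hxC : ∀ v ∉ S, x v = z (c v) := fun v hv => if_neg hv
  refine signlessRadius_lt_of_lt G hx0 fun v => ?_
  by_cases hv : v ∈ S
  · have h1 : ∑ w, (if G.Adj v w then x v + x w else 0)
        ≤ ∑ w, ((1 + x w) - if w = v then 2 else 0) := by
      refine Finset.sum_le_sum fun w _ => ?_
      rw [hxS v hv]
      by_cases hw : w = v
      · subst hw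
        simp [hxS w hv]
        norm_num
      · have := hx0 w
        rw [if_neg hw]
        split_ifs <;> linarith
    have h2 : ∑ w, x w = s + (s + ε) * F := by
      rw [← Finset.sum_add_sum_compl S, Finset.sum_congr rfl hxS]
      congr 1
      · simp [hs]
      · rw [Finset.sum_congr rfl fun w hw => hxC w (Finset.mem_compl.1 hw),
          ← Finset.sum_fiberwise Sᶜ c, hF, Finset.mul_sum]
        refine Finset.sum_congr rfl fun i _ => ?_
        rw [Finset.sum_congr rfl (g := fun _ => z i)
          fun w hw => by rw [(Finset.mem_filter.1 hw).2]]
        simp only [Finset.sum_const, nsmul_eq_mul, hz, hm]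
        ring
    rw [Finset.sum_sub_distrib, Finset.sum_add_distrib, h2] at h1
    simp only [Finset.sum_const, Finset.card_univ, nsmul_eq_mul, Finset.sum_ite_eq',
      Finset.mem_univ, if_true] at h1
    refine h1.trans_lt ?_
    rw [hxS v hv]
    linarith
  · have hvi : v ∈ Sᶜ.filter (c · = c v) := by simp [hv]
    have h1 : ∑ w, (if G.Adj v w then x v + x w else 0)
        ≤ ∑ w, (((if w ∈ S then x v + 1 else 0)
          + if w ∈ Sᶜ.filter (c · = c v) then 2 * x v else 0) - if w = v then 2 * x v else 0) := by
      refine Finset.sum_le_sum fun w _ => ?_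
      have hxv := hx0 v
      by_cases hw : w ∈ S
      · have hne : w ≠ v := fun e => hv (e ▸ hw)
        have : w ∉ Sᶜ.filter (c · = c v) := by simp [hw]
        rw [if_pos hw, if_neg this, if_neg hne, hxS w hw]
        split_ifs <;> linarith
      · rw [if_neg hw]
        by_cases hwv : w = v
        · subst hwv
          simp [hvi]
        · rw [if_neg hwv]
          by_cases hG : G.Adj v w
          · have e := hc v w hv hw hG
            have : w ∈ Sᶜ.filter (c · = c v) := by simp [hw, e]
            rw [if_pos hG, if_pos this, hxC w hw, ← e, ← hxC v hv]
            linarith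
          · rw [if_neg hG]
            split_ifs <;> linarith
    rw [Finset.sum_sub_distrib, Finset.sum_add_distrib] at h1
    simp only [Finset.sum_ite_mem, Finset.univ_inter, Finset.sum_const, nsmul_eq_mul,
      Finset.sum_ite_eq', Finset.mem_univ, if_true] at h1
    have h2 : (l - s + 2 - 2 * m (c v)) * x v = s + ε := by
      rw [hxC v hv, hz]
      exact mul_div_cancel₀ _ (hpos _).ne'
    refine h1.trans_lt ?_
    have h3 : ((Sᶜ.filter (c · = c v)).card : ℝ) = m (c v) := rfl
    rw [h3]
    linarith

/-! ### The spectral radius of the extremal graph -/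

section Adjacency

variable {n δ k : ℕ}

theorem extremalGraph_adj_inl_inl {i j : Fin δ} :
    (extremalGraph n δ k).Adj (.inl i) (.inl j) ↔ i ≠ j := by
  simp [extremalGraph, graphJoin]

theorem extremalGraph_adj_inl_inr {i : Fin δ}
    {b : Fin (δ - k + 1) ⊕ Fin (n + k - 2 * δ - 1)} :
    (extremalGraph n δ k).Adj (.inl i) (.inr b) := by
  simp [extremalGraph, graphJoin]

theorem extremalGraph_adj_inr_inl {i : Fin δ}
    {b : Fin (δ - k + 1) ⊕ Fin (n + k - 2 * δ - 1)} :
    (extremalGraph n δ k).Adj (.inr b) (.inl i) :=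
  extremalGraph_adj_inl_inr.symm

theorem extremalGraph_not_adj_isolated {a : Fin (δ - k + 1)}
    {b : Fin (δ - k + 1) ⊕ Fin (n + k - 2 * δ - 1)} :
    ¬ (extremalGraph n δ k).Adj (.inr (.inl a)) (.inr b) := by
  cases b <;> simp [extremalGraph, graphJoin]

theorem extremalGraph_not_adj_isolated' {a : Fin (δ - k + 1)}
    {b : Fin (δ - k + 1) ⊕ Fin (n + k - 2 * δ - 1)} :
    ¬ (extremalGraph n δ k).Adj (.inr b) (.inr (.inl a)) :=
  fun h => extremalGraph_not_adj_isolated h.symm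

theorem extremalGraph_adj_clique {a b : Fin (n + k - 2 * δ - 1)} :
    (extremalGraph n δ k).Adj (.inr (.inr a)) (.inr (.inr b)) ↔ a ≠ b := by
  simp [extremalGraph, graphJoin]

end Adjacency

theorem sum_ite_ne {α : Type*} [Fintype α] [DecidableEq α] (i : α) (r : ℝ) :
    ∑ j, (if i ≠ j then r else 0) = (Fintype.card α - 1) * r := by
  have : ∀ j, (if i ≠ j then r else 0) = r - if i = j then r else 0 := by
    intro j
    split_ifs <;> simp_all
  simp only [this, Finset.sum_sub_distrib, Finset.sum_const, Finset.card_univ, nsmul_eq_mul,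
    Finset.sum_ite_eq, Finset.mem_univ, if_true]
  ring

-- With value 1 on the join part, the rows of the isolated and the clique vertices force the values
-- `δ / (l - δ)` and `δ / (θ + δ)`. The row of the join part is then the cubic equation.
open Classical in
theorem exists_pos_eigenvector_extremalGraph {n δ k : ℕ} (hk : k < δ) (hn : 2 * δ + 1 < n + k)
    {l : ℝ} (hθ : 2 * ((n : ℝ) - δ + k - 2) < l) (hl : extremalCubic n δ k l = 0) :
    ∃ x : Fin δ ⊕ (Fin (δ - k + 1) ⊕ Fin (n + k - 2 * δ - 1)) → ℝ, (∀ v, 0 < x v) ∧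
      ∀ v, ∑ w, (if (extremalGraph n δ k).Adj v w then x v + x w else 0) = l * x v := by
  have hd : ((δ - k + 1 : ℕ) : ℝ) = δ - k + 1 := by
    push_cast [Nat.cast_sub hk.le]
    ring
  have hM : ((n + k - 2 * δ - 1 : ℕ) : ℝ) = n + k - 2 * δ - 1 := by
    rw [Nat.sub_sub, Nat.cast_sub hn.le]
    push_cast
    ring
  have hnr : 2 * (δ : ℝ) + 1 + 1 ≤ n + k := by exact_mod_cast hn
  have hδ : (0 : ℝ) < δ := by exact_mod_cast (Nat.zero_le k).trans_lt hk
  have hkr : (k : ℝ) + 1 ≤ δ := by exact_mod_cast hk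
  set θ : ℝ := l - 2 * ((n : ℝ) - δ + k - 2) with hθd
  have hθ0 : 0 < θ := sub_pos.2 hθ
  have hA : 0 < l - δ := by linarith
  have hB : 0 < θ + δ := by linarith
  rw [extremalCubic_eq, ← hθd] at hl
  have row := quotient_row_eq (s := (δ : ℝ)) (m := (δ : ℝ) - k + 1) (A := l - δ) (θ := θ)
    (N := (n : ℝ) - δ + k - 1) hA.ne' hB.ne' (by linear_combination hl)
  set a : ℝ := δ / (l - δ) with ha
  set b : ℝ := δ / (θ + δ) with hb
  have ha0 : 0 < a := div_pos hδ hA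
  have hb0 : 0 < b := div_pos hδ hB
  have haA : a * (l - δ) = δ := div_mul_cancel₀ _ hA.ne'
  have hbB : b * (θ + δ) = δ := div_mul_cancel₀ _ hB.ne'
  have row' : ((δ : ℝ) - k + 1) * a + ((n : ℝ) - δ + k - 1 - δ) * b
      = θ + 2 * ((n : ℝ) - δ + k - 1 - 1) - (δ - k + 1 + (n - δ + k - 1) + δ - 2) := by
    rw [← row, ha, hb]
    ring
  refine ⟨Sum.elim (fun _ => 1) (Sum.elim (fun _ => a) (fun _ => b)), ?_, ?_⟩
  · rintro (v | v | v)
    · exact one_pos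
    · exact ha0
    · exact hb0
  · rintro (v | v | v)
    · simp only [Fintype.sum_sum_type, extremalGraph_adj_inl_inl, extremalGraph_adj_inl_inr,
        Sum.elim_inl, Sum.elim_inr, if_true, sum_ite_ne, Finset.sum_const, Finset.card_univ,
        Fintype.card_fin, nsmul_eq_mul, hd, hM]
      linear_combination row'
    · simp only [Fintype.sum_sum_type, extremalGraph_not_adj_isolated, extremalGraph_adj_inr_inl,
        Sum.elim_inl, Sum.elim_inr, if_true, if_false, Finset.sum_const,
        Finset.card_univ, Fintype.card_fin, nsmul_eq_mul]
      linear_combination -haA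
    · simp only [Fintype.sum_sum_type, extremalGraph_not_adj_isolated', extremalGraph_adj_inr_inl,
        extremalGraph_adj_clique, Sum.elim_inl, Sum.elim_inr, if_true, if_false, sum_ite_ne,
        Finset.sum_const, Finset.card_univ, Fintype.card_fin, nsmul_eq_mul, hM]
      linear_combination -hbB

/-- A positive eigenvector belongs to the spectral radius. Consequently the cubic has at most one
root above `2 (N - 1)`, which is why that root is the largest. -/
theorem eq_signlessRadius_extremalGraph_of_root {n δ k : ℕ} (hk : k < δ)
    (hn : 2 * δ + 1 < n + k) {l : ℝ} (hθ : 2 * ((n : ℝ) - δ + k - 2) < l)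
    (hl : extremalCubic n δ k l = 0) : l = signlessRadius (extremalGraph n δ k) := by
  classical
  have : Nonempty (Fin δ) := ⟨⟨0, (Nat.zero_le k).trans_lt hk⟩⟩
  obtain ⟨x, hx, h⟩ := exists_pos_eigenvector_extremalGraph hk hn hθ hl
  refine le_antisymm (le_signlessRadius_of_eigenvector _ (y := x) ?_ h)
    (signlessRadius_le_of_eigenvector _ hx h)
  intro e
  have := hx (.inl (Classical.arbitrary _))
  simp [e] at this

theorem exists_root_extremalCubic {n δ k : ℝ} (hk : 0 ≤ k) (hkδ : k + 1 ≤ δ)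
    (hn : 9 * δ - 2 * k + 12 ≤ n) :
    ∃ l, 2 * (n - δ + k - 2) < l ∧ extremalCubic n δ k l = 0 := by
  set N := n - δ + k - 1 with hN
  have hNδ : 2 * δ + 10 ≤ N := by linarith
  have hNd : δ - k + 1 ≤ N := by linarith
  have hcont : Continuous (extremalCubic n δ k) := by
    unfold extremalCubic
    fun_prop
  have h0 : extremalCubic n δ k (2 * (N - 1)) < 0 := by
    have : extremalCubic n δ k (2 * (N - 1)) = -((δ - k + 1) * (2 * (N - 1)) * δ) := by
      rw [extremalCubic_eq, hN]
      ring
    rw [this, neg_lt_zero]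
    exact mul_pos (mul_pos (by linarith) (by linarith)) (by linarith)
  -- The point `θ = 2 * N`, where `θ * (θ + N) = 6 * N ^ 2`; the bounds `d ≤ N` and `δ ≤ N` suffice.
  have h1 : 0 < extremalCubic n δ k (2 * (N - 1) + 2 * N) := by
    have : extremalCubic n δ k (2 * (N - 1) + 2 * N)
        = (4 * N - 2 - δ) * (6 * N ^ 2) - (δ - k + 1) * (4 * N - 2) * (2 * N + δ) := by
      rw [extremalCubic_eq, hN]
      ring
    rw [this, sub_pos]
    calc (δ - k + 1) * (4 * N - 2) * (2 * N + δ) ≤ N * (4 * N - 2) * (3 * N) := by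
          have : 0 ≤ 4 * N - 2 := by linarith
          have : 0 ≤ N := by linarith
          gcongr <;> linarith
      _ = (2 * N - 1) * (6 * N ^ 2) := by ring
      _ < (4 * N - 2 - δ) * (6 * N ^ 2) := by
          have : 0 < N := by linarith
          exact mul_lt_mul_of_pos_right (by linarith) (by positivity)
  obtain ⟨l, hl, hl0⟩ := intermediate_value_Icc (by linarith : 2 * (N - 1) ≤ 2 * (N - 1) + 2 * N)
    hcont.continuousOn ⟨h0.le, h1.le⟩
  refine ⟨l, lt_of_le_of_ne (by linarith [hl.1]) ?_, hl0⟩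
  intro e
  have : l = 2 * (N - 1) := by rw [← e, hN]; ring
  rw [this] at hl0
  exact h0.ne hl0

/-- The spectral radius of the extremal graph is the largest root of the cubic; moreover it exceeds
twice the order minus one of its largest clique. -/
theorem signlessRadius_extremalGraph {n δ k : ℕ} (hk : k < δ)
    (hn : 9 * (δ : ℤ) - 2 * (k : ℤ) + 12 ≤ (n : ℤ)) :
    IsGreatest {x : ℝ | extremalCubic n δ k x = 0} (signlessRadius (extremalGraph n δ k)) ∧
      2 * ((n : ℝ) - δ + k - 2) < signlessRadius (extremalGraph n δ k) := by
  have hkr : (k : ℝ) + 1 ≤ δ := by exact_mod_cast hk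
  have hnr : 9 * (δ : ℝ) - 2 * k + 12 ≤ n := by exact_mod_cast hn
  have hn' : 2 * δ + 1 < n + k := by omega
  obtain ⟨l, hθ, hl⟩ := exists_root_extremalCubic (Nat.cast_nonneg k) hkr hnr
  have e := eq_signlessRadius_extremalGraph_of_root hk hn' hθ hl
  rw [← e]
  refine ⟨⟨hl, fun μ hμ => ?_⟩, hθ⟩
  by_contra! h
  have := eq_signlessRadius_extremalGraph_of_root hk hn' (hθ.trans h) hμ
  exact h.ne (e.trans this.symm)

/-! ### Tutte's theorem, and the failure of factor-criticality for the extremal graph -/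

/-- Tutte's theorem for factor-critical graphs: if `G` is not `k`-factor-critical, then some set `S`
of at least `k` vertices separates the others into `|S| - k + 2` mutually nonadjacent classes. -/
theorem exists_partition_of_not_isFactorCritical {V : Type*} [Fintype V] [DecidableEq V]
    (G : SimpleGraph V) {k : ℕ} (hpar : k ≡ Fintype.card V [MOD 2])
    (h : ¬ IsFactorCritical G k) :
    ∃ S : Finset V, k ≤ S.card ∧ ∃ c : V → Fin (S.card - k + 2),
      (∀ v w, v ∉ S → w ∉ S → G.Adj v w → c v = c w) ∧ ∀ i, ∃ v, v ∉ S ∧ c v = i := by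
  classical
  unfold IsFactorCritical at h
  push Not at h
  obtain ⟨T, hT, hM⟩ := h
  have hM' : ¬ ∃ M : (G.induce {v : V | v ∉ T}).Subgraph, M.IsPerfectMatching :=
    fun ⟨M, h⟩ => hM M h
  rw [SimpleGraph.tutte] at hM'
  push Not at hM'
  obtain ⟨u, hu⟩ := hM'
  unfold SimpleGraph.IsTutteViolator at hu
  set K := ((⊤ : (G.induce {v : V | v ∉ T}).Subgraph).deleteVerts u).coe with hK
  have hcardT : Nat.card {v : V | v ∉ T} = Fintype.card V - k := by
    rw [Nat.card_coe_set_eq, ← hT, ← Finset.card_compl, ← Set.ncard_coe_finset]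
    congr 1
    ext v
    simp
  have hcardK : Nat.card ((⊤ : (G.induce {v : V | v ∉ T}).Subgraph).deleteVerts u).verts
      = Fintype.card V - k - u.ncard := by
    rw [Nat.card_coe_set_eq, SimpleGraph.Subgraph.deleteVerts_verts, SimpleGraph.Subgraph.verts_top,
      ← Set.compl_eq_univ_sdiff, Set.ncard_compl, hcardT]
  have hkV : k ≤ Fintype.card V := hT ▸ Finset.card_le_univ T
  have huV : u.ncard ≤ Fintype.card V - k := hcardT ▸ Set.ncard_le_card u
  have hodd := K.odd_ncard_oddComponents
  rw [hcardK] at hodd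
  -- A Tutte violator gives only one component more than `|u|`; as `|V| - k` is even, the number of
  -- odd components has the parity of `|u|`, which gains another.
  have ht : u.ncard + 2 ≤ K.oddComponents.ncard := by
    unfold Nat.ModEq at hpar
    rw [Nat.odd_iff, Nat.odd_iff] at hodd
    omega
  have hdisj : Disjoint T (u.toFinset.map (Function.Embedding.subtype _)) := by
    rw [Finset.disjoint_left]
    intro v hv hv'
    obtain ⟨w, -, rfl⟩ := Finset.mem_map.1 hv'
    exact w.2 hv
  set S : Finset V := T ∪ u.toFinset.map (Function.Embedding.subtype _) with hS
  have hScard : S.card = k + u.ncard := by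
    rw [hS, Finset.card_union_of_disjoint hdisj, hT, Finset.card_map, Set.ncard_eq_toFinset_card']
  have hSk : S.card - k + 2 = u.ncard + 2 := by omega
  refine ⟨S, by omega, ?_⟩
  rw [hSk]
  have hmem : ∀ v (_ : v ∉ S), ∃ x : ((⊤ : (G.induce {v : V | v ∉ T}).Subgraph).deleteVerts u).verts,
      (x : {v : V | v ∉ T}).1 = v := by
    intro v hv
    rw [hS, Finset.mem_union, not_or] at hv
    refine ⟨⟨⟨v, hv.1⟩, ?_⟩, rfl⟩
    rw [SimpleGraph.Subgraph.deleteVerts_verts]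
    refine ⟨trivial, fun hvu => hv.2 (Finset.mem_map.2 ⟨_, Set.mem_toFinset.2 hvu, rfl⟩)⟩
  obtain ⟨φ⟩ : Nonempty (Fin (u.ncard + 2) ↪ K.oddComponents) := by
    apply Function.Embedding.nonempty_of_card_le
    rw [Fintype.card_fin, ← Nat.card_eq_fintype_card, Nat.card_coe_set_eq]
    exact ht
  have hinj : Function.Injective (fun i => (φ i).1) := Subtype.val_injective.comp φ.injective
  have hne : Nonempty ((⊤ : (G.induce {v : V | v ∉ T}).Subgraph).deleteVerts u).verts :=
    ⟨(φ 0).1.exists_rep.choose⟩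
  choose! f hf using fun v (hv : v ∉ S) => hmem v hv
  -- The `|u| + 2` chosen odd components get their own indices; `invFun` sends all other components
  -- to one default index, which merges them into a single class.
  refine ⟨fun v => Function.invFun (fun i => (φ i).1) (K.connectedComponentMk (f v)),
    fun v w hv hw hvw => ?_, fun i => ?_⟩
  · have hadj : K.Adj (f v) (f w) := by
      rw [hK, SimpleGraph.Subgraph.coe_adj, SimpleGraph.Subgraph.deleteVerts_adj]
      refine ⟨trivial, (f v).2.2, trivial, (f w).2.2, ?_⟩
      rw [SimpleGraph.Subgraph.top_adj, SimpleGraph.comap_adj]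
      simpa [hf v hv, hf w hw] using hvw
    simp only [SimpleGraph.ConnectedComponent.sound hadj.reachable]
  · obtain ⟨x, hx⟩ := (φ i).1.exists_rep
    have hxS : x.1.1 ∉ S := by
      rw [hS, Finset.mem_union, not_or]
      refine ⟨x.1.2, fun hxu => ?_⟩
      obtain ⟨w, hw, e⟩ := Finset.mem_map.1 hxu
      have : w = x.1 := Subtype.ext e
      exact x.2.2 (this ▸ Set.mem_toFinset.1 hw)
    refine ⟨x.1.1, hxS, ?_⟩
    have : f x.1.1 = x := Subtype.ext (Subtype.ext (hf _ hxS))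
    simp only [this]
    have hx' : K.connectedComponentMk x = (fun i => (φ i).1) i := hx
    rw [hx', Function.leftInverse_invFun hinj]

/-- The extremal graph is not `k`-factor-critical: after deleting `k` of the `δ` vertices of the
join part, the `δ - k + 1` vertices of the independent part have only `δ - k` neighbours. -/
theorem not_isFactorCritical_of_iso_extremalGraph {V : Type*} {G : SimpleGraph V} {n δ k : ℕ}
    (hk : k < δ) (e : G ≃g extremalGraph n δ k) : ¬ IsFactorCritical G k := by
  classical
  intro h
  let ψ : Fin k ↪ V := ⟨fun i => e.symm (.inl (Fin.castLE hk.le i)), fun i j hij => by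
    simpa using hij⟩
  set T : Finset V := Finset.univ.map ψ with hT
  obtain ⟨M, hM⟩ := h T (by simp [hT])
  have hmemT : ∀ i : Fin δ, (i : ℕ) < k → e.symm (.inl i) ∈ T := fun i hi =>
    Finset.mem_map.2 ⟨⟨i, hi⟩, Finset.mem_univ _, rfl⟩
  have hnot : ∀ a : Fin (δ - k + 1), e.symm (.inr (.inl a)) ∉ T := by
    intro a ha
    obtain ⟨i, -, hi⟩ := Finset.mem_map.1 ha
    have := e.symm.injective hi
    simp at this
  have hpartner : ∀ a : Fin (δ - k + 1), ∃ i : Fin δ, ∃ hi : e.symm (.inl i) ∉ T,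
      M.Adj ⟨e.symm (.inr (.inl a)), hnot a⟩ ⟨e.symm (.inl i), hi⟩ := by
    intro a
    obtain ⟨w, hw, -⟩ := hM.1 (hM.2 ⟨e.symm (.inr (.inl a)), hnot a⟩)
    have hadj : G.Adj (e.symm (.inr (.inl a))) w.1 := M.adj_sub hw
    rw [← e.map_adj_iff, RelIso.apply_symm_apply] at hadj
    rcases hew : e w.1 with i | b
    · have hwi : w.1 = e.symm (.inl i) := by rw [← hew, RelIso.symm_apply_apply]
      refine ⟨i, hwi ▸ w.2, ?_⟩
      have : w = ⟨e.symm (.inl i), hwi ▸ w.2⟩ := Subtype.ext hwi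
      rwa [← this]
    · rw [hew] at hadj
      exact absurd hadj extremalGraph_not_adj_isolated
  choose f hf hadj using hpartner
  have hkf : ∀ a, k ≤ (f a : ℕ) := fun a => not_lt.1 fun hlt => hf a (hmemT _ hlt)
  have hinj : Function.Injective
      (fun a => (⟨(f a : ℕ) - k, by have := (f a).2; have := hkf a; omega⟩ : Fin (δ - k))) := by
    intro a b hab
    have h1 : (f a : ℕ) - k = (f b : ℕ) - k := congrArg Fin.val hab
    have h2 : f a = f b := Fin.ext (by have := hkf a; have := hkf b; omega)
    have ha := (hadj a).symm
    have hb := (hadj b).symm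
    simp only [← h2] at hb
    have := (hM.1 (hM.2 _)).unique ha hb
    simpa using this
  have := Fintype.card_le_of_injective _ hinj
  simp at this

/-! ### Recognising the extremal graph -/

/-- A graph of spectral radius at least `q(H)` which, up to missing edges, has the structure of the
extremal graph `H`, is isomorphic to `H`. -/
theorem nonempty_iso_extremalGraph {V : Type*} [Fintype V] [Nonempty V] [DecidableEq V]
    {G : SimpleGraph V} {n δ k : ℕ} (hk : k < δ)
    (hnδ : 9 * (δ : ℤ) - 2 * (k : ℤ) + 12 ≤ (n : ℤ)) (hn : Fintype.card V = n)
    {S I C : Finset V} (hSI : Disjoint S I) (hSC : Disjoint S C) (hIC : Disjoint I C)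
    (hS : S.card = δ) (hI : I.card = δ - k + 1) (hC : C.card = n + k - 2 * δ - 1)
    (hII : ∀ v ∈ I, ∀ w ∈ I, ¬ G.Adj v w) (hICadj : ∀ v ∈ I, ∀ w ∈ C, ¬ G.Adj v w)
    (hq : signlessRadius (extremalGraph n δ k) ≤ signlessRadius G) :
    Nonempty (G ≃g extremalGraph n δ k) := by
  classical
  let g : Fin δ ⊕ (Fin (δ - k + 1) ⊕ Fin (n + k - 2 * δ - 1)) → V :=
    Sum.elim (fun i => (S.equivFinOfCardEq hS).symm i)
      (Sum.elim (fun i => (I.equivFinOfCardEq hI).symm i)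
        (fun i => (C.equivFinOfCardEq hC).symm i))
  have gS : ∀ i, g (.inl i) ∈ S := fun i => ((S.equivFinOfCardEq hS).symm i).2
  have gI : ∀ i, g (.inr (.inl i)) ∈ I := fun i => ((I.equivFinOfCardEq hI).symm i).2
  have gC : ∀ i, g (.inr (.inr i)) ∈ C := fun i => ((C.equivFinOfCardEq hC).symm i).2
  have hinj : Function.Injective g := by
    refine Function.Injective.sumElim (Subtype.val_injective.comp (Equiv.injective _))
      (Function.Injective.sumElim (Subtype.val_injective.comp (Equiv.injective _))
        (Subtype.val_injective.comp (Equiv.injective _))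
        fun a b hab => Finset.disjoint_left.1 hIC (gI a) ?_) ?_
    · have : g (.inr (.inl a)) = g (.inr (.inr b)) := hab
      exact this ▸ gC b
    · rintro a (b | b) hab
      · have : g (.inl a) = g (.inr (.inl b)) := hab
        exact Finset.disjoint_left.1 hSI (gS a) (this ▸ gI b)
      · have : g (.inl a) = g (.inr (.inr b)) := hab
        exact Finset.disjoint_left.1 hSC (gS a) (this ▸ gC b)
  have hbij : Function.Bijective g := by
    rw [Fintype.bijective_iff_injective_and_card]
    refine ⟨hinj, ?_⟩
    simp only [Fintype.card_sum, Fintype.card_fin, hn]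
    omega
  let E := Equiv.ofBijective g hbij
  have hE : ∀ a, E a = g a := fun a => rfl
  have hle : G.comap E ≤ extremalGraph n δ k := by
    rintro (a | a | a) (b | b | b) hab <;> rw [SimpleGraph.comap_adj, hE, hE] at hab
    · exact extremalGraph_adj_inl_inl.2 fun h => hab.ne (h ▸ rfl)
    · exact extremalGraph_adj_inl_inr
    · exact extremalGraph_adj_inl_inr
    · exact extremalGraph_adj_inr_inl
    · exact absurd hab (hII _ (gI a) _ (gI b))
    · exact absurd hab (hICadj _ (gI a) _ (gC b))
    · exact extremalGraph_adj_inr_inl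
    · exact absurd hab.symm (hICadj _ (gI b) _ (gC a))
    · exact extremalGraph_adj_clique.2 fun h => hab.ne (h ▸ rfl)
  let iso : G.comap E ≃g G := SimpleGraph.Iso.comap E G
  have hq' := hq.trans (signlessRadius_le_of_iso iso.symm)
  obtain ⟨hroot, hθ⟩ := signlessRadius_extremalGraph hk hnδ
  have : Nonempty (Fin δ) := ⟨⟨0, (Nat.zero_le k).trans_lt hk⟩⟩
  obtain ⟨x, hx, h⟩ := exists_pos_eigenvector_extremalGraph hk (by omega) hθ hroot.1
  have heq : G.comap E = extremalGraph n δ k := by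
    refine eq_of_le_signlessRadius hle (u := .inl (Classical.arbitrary _)) ?_ hx h hq'
    rintro (w | w) hw
    · exact extremalGraph_adj_inl_inl.2 fun h => hw (h ▸ rfl)
    · exact extremalGraph_adj_inl_inr
  exact ⟨heq ▸ iso.symm⟩

/-! ### Class sizes and the reduction to extreme configurations -/

/-- All neighbours of `v` lie in `S` or in the class of `v` with `v` itself removed. -/
theorem minDegree_lt_card_add_card_class {V ι : Type*} [Fintype V] [DecidableEq V] [DecidableEq ι]
    (G : SimpleGraph V) [DecidableRel G.Adj] {S : Finset V} {c : V → ι}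
    (hc : ∀ v w, v ∉ S → w ∉ S → G.Adj v w → c v = c w) {v : V} (hv : v ∉ S) :
    G.minDegree < S.card + (Sᶜ.filter (c · = c v)).card := by
  have hvi : v ∈ Sᶜ.filter (c · = c v) := by simp [hv]
  have hsub : G.neighborFinset v ⊆ S ∪ (Sᶜ.filter (c · = c v)).erase v := by
    intro w hw
    rw [SimpleGraph.mem_neighborFinset] at hw
    by_cases hwS : w ∈ S
    · exact Finset.mem_union_left _ hwS
    · refine Finset.mem_union_right _ (Finset.mem_erase.2 ⟨hw.ne', ?_⟩)
      simp [hwS, hc v w hv hwS hw]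
  have h1 := (Finset.card_le_card hsub).trans (Finset.card_union_le _ _)
  rw [SimpleGraph.card_neighborFinset_eq_degree, Finset.card_erase_of_mem hvi] at h1
  have h2 := G.minDegree_le_degree v
  have h3 := Finset.card_pos.2 ⟨v, hvi⟩
  omega

section Partition

variable {V ι : Type*} [Fintype V] [DecidableEq V] [Fintype ι] [DecidableEq ι]

theorem sum_card_classes (S : Finset V) (c : V → ι) :
    ∑ i, ((Sᶜ.filter (c · = i)).card : ℝ) = Fintype.card V - S.card := by
  rw [← Nat.cast_sum, ← Finset.card_eq_sum_card_fiberwise fun _ _ =>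
      Finset.mem_coe.2 (Finset.mem_univ _),
    Finset.card_compl, Nat.cast_sub (Finset.card_le_univ S)]

theorem card_class_add_le_extreme {S : Finset V} {c : V → ι} {p N : ℝ}
    (hp : ∀ i, p ≤ ((Sᶜ.filter (c · = i)).card : ℝ))
    (hN : (Fintype.card V : ℝ) = N + (Fintype.card ι - 1) * p) (i : ι) :
    ((Sᶜ.filter (c · = i)).card : ℝ) ≤ N - S.card :=
  le_of_sum_eq_extreme hp (by rw [sum_card_classes, hN]; ring) i

variable [Nonempty V]

/-- Comparison with `K_s ∨ ((t - 1) K_p ∪ K_{N - s})`, where `t` is the number of classes. By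
convexity this is the worst case, and `h` is its join row with denominators cleared. -/
theorem signlessRadius_lt_of_quotient (G : SimpleGraph V) (S : Finset V) (c : V → ι)
    (hc : ∀ v w, v ∉ S → w ∉ S → G.Adj v w → c v = c w) {p N θ : ℝ} (hp0 : 0 ≤ p) (hθ : 0 < θ)
    (hp : ∀ i, p ≤ ((Sᶜ.filter (c · = i)).card : ℝ))
    (hN : (Fintype.card V : ℝ) = N + (Fintype.card ι - 1) * p)
    (hA : 0 < θ + 2 * (N - 1) - S.card + 2 - 2 * p)
    (h : (Fintype.card ι - 1) * p * (θ + 2 * (N - 1) - S.card + 2 - 2 * p + S.card) * (θ + S.card)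
      < θ * (θ + N) * (θ + 2 * (N - 1) - S.card + 2 - 2 * p)) :
    signlessRadius G < θ + 2 * (N - 1) := by
  have hs : (0 : ℝ) ≤ S.card := Nat.cast_nonneg _
  have hB : 0 < θ + (S.card : ℝ) := by linarith
  have hM : θ + 2 * (N - 1) - S.card + 2 - 2 * (N - S.card) = θ + S.card := by ring
  have row := quotient_row_lt hA hB h
  have hle := card_class_add_le_extreme hp hN
  have hsum := sum_div_sub_two_mul_le (c := θ + 2 * (N - 1) - S.card + 2) (M := N - S.card)
    (by linarith) hA (by rw [hM]; exact hB) hp (by rw [sum_card_classes, hN]; ring)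
  rw [hM, ← mul_div_assoc] at hsum
  refine signlessRadius_lt_of_partition G S c hc (fun i => ?_) ?_
  · linarith [hle i]
  · refine (mul_le_mul_of_nonneg_left hsum hs).trans_lt (row.trans_eq ?_)
    rw [hN]
    ring

theorem signlessRadius_lt_of_quotient_of_strict (G : SimpleGraph V) (S : Finset V) (c : V → ι)
    (hc : ∀ v w, v ∉ S → w ∉ S → G.Adj v w → c v = c w) {p N θ : ℝ} (hp0 : 0 ≤ p) (hθ : 0 < θ)
    (hp : ∀ i, p ≤ ((Sᶜ.filter (c · = i)).card : ℝ)) (hS : 0 < (S.card : ℝ))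
    (hlt : ∃ i, p < ((Sᶜ.filter (c · = i)).card : ℝ) ∧
      ((Sᶜ.filter (c · = i)).card : ℝ) < N - S.card)
    (hN : (Fintype.card V : ℝ) = N + (Fintype.card ι - 1) * p)
    (hA : 0 < θ + 2 * (N - 1) - S.card + 2 - 2 * p)
    (h : θ * (θ + N) * (θ + 2 * (N - 1) - S.card + 2 - 2 * p) =
      (Fintype.card ι - 1) * p * (θ + 2 * (N - 1) - S.card + 2 - 2 * p + S.card)
        * (θ + S.card)) :
    signlessRadius G < θ + 2 * (N - 1) := by
  have hB : 0 < θ + (S.card : ℝ) := by linarith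
  have hM : θ + 2 * (N - 1) - S.card + 2 - 2 * (N - S.card) = θ + S.card := by ring
  have row := quotient_row_eq hA.ne' hB.ne' h
  have hle := card_class_add_le_extreme hp hN
  have hsum := sum_div_sub_two_mul_lt (c := θ + 2 * (N - 1) - S.card + 2) (M := N - S.card)
    (by linarith) hA (by rw [hM]; exact hB) hp (by rw [sum_card_classes, hN]; ring) hlt
  rw [hM, ← mul_div_assoc] at hsum
  refine signlessRadius_lt_of_partition G S c hc (fun i => ?_) ?_
  · linarith [hle i]
  · refine (mul_lt_mul_of_pos_left hsum hS).trans_eq (row.trans ?_)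
    rw [hN]
    ring

end Partition

/-- The total excess over `p` is `M - p`, and the index `i₀` already uses it up. -/
theorem eq_of_sum_eq_extreme {ι : Type*} [Fintype ι] [DecidableEq ι] {y : ι → ℝ} {p M : ℝ}
    (hp : ∀ i, p ≤ y i) (hsum : ∑ i, y i = (Fintype.card ι - 1) * p + M) {i₀ : ι} (h0 : y i₀ = M)
    {i : ι} (hi : i ≠ i₀) : y i = p := by
  have h : ∑ j, (y j - p) = M - p := by
    rw [Finset.sum_sub_distrib, hsum]
    simp only [Finset.sum_const, Finset.card_univ, nsmul_eq_mul]
    ring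
  rw [← Finset.add_sum_erase _ _ (Finset.mem_univ i₀), h0] at h
  have h2 := Finset.single_le_sum (f := fun j => y j - p) (fun j _ => sub_nonneg.2 (hp j))
    (Finset.mem_erase.2 ⟨hi, Finset.mem_univ i⟩)
  linarith [hp i]

/-! ### The three cases `s < δ`, `s = δ`, `s > δ` -/

theorem nonempty_iso_of_not_isFactorCritical {V : Type*} [Fintype V] (G : SimpleGraph V)
    [DecidableRel G.Adj] (n δ k : ℕ) (hn : Fintype.card V = n) (hδ : G.minDegree = δ)
    (hnδ : 9 * (δ : ℤ) - 2 * (k : ℤ) + 12 ≤ (n : ℤ)) (hk : k < δ) (hpar : k ≡ n [MOD 2])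
    (hq : signlessRadius (extremalGraph n δ k) ≤ signlessRadius G)
    (hfc : ¬ IsFactorCritical G k) : Nonempty (G ≃g extremalGraph n δ k) := by
  classical
  have hV : Nonempty V := Fintype.card_pos_iff.1 (by omega)
  obtain ⟨S, hkS, c, hc, hsurj⟩ :=
    exists_partition_of_not_isFactorCritical G (by rwa [hn]) hfc
  obtain ⟨hroot, hθ⟩ := signlessRadius_extremalGraph hk hnδ
  have hl := hroot.1
  rw [Set.mem_ofPred_eq, extremalCubic_eq] at hl
  set l := signlessRadius (extremalGraph n δ k) with hldef
  set θ : ℝ := l - 2 * ((n : ℝ) - δ + k - 2) with hθdef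
  have hθ0 : 0 < θ := sub_pos.2 hθ
  set N : ℝ := (n : ℝ) - δ + k - 1 with hNdef
  have hlN : l = θ + 2 * (N - 1) := by rw [hθdef, hNdef]; ring
  set s : ℝ := (S.card : ℝ) with hs
  have hkr : (k : ℝ) + 1 ≤ δ := by exact_mod_cast hk
  have hk0 : (0 : ℝ) ≤ k := Nat.cast_nonneg k
  have hks : (k : ℝ) ≤ s := by rw [hs]; exact_mod_cast hkS
  have hnr : 9 * (δ : ℝ) - 2 * k + 12 ≤ n := by exact_mod_cast hnδ
  have hcard : (Fintype.card (Fin (S.card - k + 2)) : ℝ) - 1 = s - k + 1 := by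
    rw [Fintype.card_fin]
    push_cast [Nat.cast_sub hkS]
    ring
  have hVn : (Fintype.card V : ℝ) = n := by rw [hn]
  have hone : ∀ i, (1 : ℝ) ≤ ((Sᶜ.filter (c · = i)).card : ℝ) := by
    intro i
    obtain ⟨v, hv, hvi⟩ := hsurj i
    exact_mod_cast Finset.card_pos.2 ⟨v, by simp [hv, hvi]⟩
  rcases lt_trichotomy S.card δ with hlt | heq | hgt
  · exfalso
    have hsδ : s + 1 ≤ δ := by rw [hs]; exact_mod_cast hlt
    have hp : ∀ i, (δ : ℝ) - s + 1 ≤ ((Sᶜ.filter (c · = i)).card : ℝ) := by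
      intro i
      obtain ⟨v, hv, rfl⟩ := hsurj i
      have := minDegree_lt_card_add_card_class G hc hv
      rw [hδ] at this
      have : (δ : ℝ) + 1 ≤ s + ((Sᶜ.filter (c · = c v)).card : ℝ) := by
        rw [hs]
        exact_mod_cast this
      linarith
    -- Here `s - k + 1` classes of the least size `δ - s + 1` are split off. The clique order falls
    -- by `(s - k) * (δ - s)`, so `θ` must grow by twice that to keep `l` fixed.
    have hN' : (Fintype.card V : ℝ) = (N - (s - k) * (δ - s))
        + (Fintype.card (Fin (S.card - k + 2)) - 1) * (δ - s + 1) := by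
      rw [hcard, hVn, hNdef]
      ring
    have hw : (s - k) * (δ - s) + (s + (δ - s)) + 1 ≤ N := by
      have := (hp 0).trans (card_class_add_le_extreme hp hN' 0)
      linarith
    have hw0 : 0 ≤ (s - k) * (δ - s) := mul_nonneg (by linarith) (by linarith)
    have hl' : θ + 2 * ((s - k) * (δ - s)) + 2 * ((N - (s - k) * (δ - s)) - 1) = l := by
      rw [hlN]; ring
    have := signlessRadius_lt_of_quotient G S c hc (θ := θ + 2 * ((s - k) * (δ - s)))
      (by linarith) (by linarith) hp hN'
    rw [hl', hcard] at this
    refine (this ?_ ?_).not_ge hq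
    · linarith
    · by_cases hu : S.card = k
      · have hsk : s = k := by rw [hs]; exact_mod_cast hu
        have := quotient_ineq_boundary (N := N) (s := s) (v := δ - s) (d := δ - k + 1) hθ0
          (by linarith) (by linarith) (by linarith) (by linarith)
          (by rw [← hlN]; linear_combination hl)
        rw [← hlN] at this
        rw [← hs, hsk]
        rw [hsk] at this
        linarith
      · have hsk : (k : ℝ) + 1 ≤ s := by
          rw [hs]
          exact_mod_cast Nat.lt_of_le_of_ne hkS (Ne.symm hu)
        have := quotient_ineq_small (N := N) (s := s) (u := s - k) (v := δ - s) hθ0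
          (by linarith) (by linarith) (by linarith) (by linarith) hw
        rw [← hlN] at this
        linarith
  · have hsδ : s = δ := by rw [hs]; exact_mod_cast heq
    have hN' : (Fintype.card V : ℝ) = N + (Fintype.card (Fin (S.card - k + 2)) - 1) * 1 := by
      rw [hcard, hVn, hNdef, hsδ]
      ring
    -- The extreme configuration is now that of `H`, whose join row is an equality at `l`; a class
    -- of intermediate size would make the convexity bound strict and give `q(G) < l`.
    have hext : ∀ i, ((Sᶜ.filter (c · = i)).card : ℝ) = 1 ∨
        ((Sᶜ.filter (c · = i)).card : ℝ) = N - s := by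
      intro i
      by_contra! hcon
      have := signlessRadius_lt_of_quotient_of_strict G S c hc zero_le_one hθ0 hone
        (by linarith) ⟨i, lt_of_le_of_ne (hone i) hcon.1.symm,
          lt_of_le_of_ne (card_class_add_le_extreme hone hN' i) hcon.2⟩ hN'
      rw [← hlN, hcard] at this
      refine (this (by linarith) ?_).not_ge hq
      rw [← hs, hsδ]
      linear_combination hl
    have hsum : ∑ i, ((Sᶜ.filter (c · = i)).card : ℝ)
        = (Fintype.card (Fin (S.card - k + 2)) - 1) * 1 + (N - s) := by
      rw [sum_card_classes, hN']
      ring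
    obtain ⟨i₀, hi₀⟩ : ∃ i, ((Sᶜ.filter (c · = i)).card : ℝ) = N - s := by
      -- If all classes were singletons, the total would give `N - s = 1`, but `N` is far larger
      -- than `δ = s`.
      by_contra! hcon
      have h1 : ∀ i, ((Sᶜ.filter (c · = i)).card : ℝ) = 1 := fun i =>
        (hext i).resolve_right (hcon i)
      simp only [h1, Finset.sum_const, Finset.card_univ, nsmul_eq_mul] at hsum
      linarith
    have hone' : ∀ i, i ≠ i₀ → (Sᶜ.filter (c · = i)).card = 1 := fun i hi => by
      exact_mod_cast eq_of_sum_eq_extreme hone hsum hi₀ hi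
    have hC : (Sᶜ.filter (c · = i₀)).card = n + k - 2 * δ - 1 := by
      have : ((Sᶜ.filter (c · = i₀)).card : ℝ) + δ + δ + 1 = n + k := by
        rw [hi₀, hNdef, hsδ]
        ring
      have : (Sᶜ.filter (c · = i₀)).card + δ + δ + 1 = n + k := by exact_mod_cast this
      omega
    have hI : (Sᶜ.filter (c · ≠ i₀)).card = δ - k + 1 := by
      have h1 := Finset.card_filter_add_card_filter_not (s := Sᶜ) (c · = i₀)
      rw [Finset.card_compl, hn, hC] at h1
      simp only [ne_eq]
      omega
    refine nonempty_iso_extremalGraph hk hnδ hn (S := S) (I := Sᶜ.filter (c · ≠ i₀))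
      (C := Sᶜ.filter (c · = i₀)) ?_ ?_ ?_ heq hI hC ?_ ?_ hq
    · exact disjoint_compl_right.mono_right (Finset.filter_subset _ _)
    · exact disjoint_compl_right.mono_right (Finset.filter_subset _ _)
    · exact (Finset.disjoint_filter_filter_not _ _ _).symm
    · intro v hv w hw hadj
      simp only [Finset.mem_filter, Finset.mem_compl] at hv hw
      have e := hc v w hv.1 hw.1 hadj
      exact hadj.ne (Finset.card_le_one.1 (hone' (c v) hv.2).le v (by simp [hv.1]) w
        (by simp [hw.1, e]))
    · intro v hv w hw hadj
      simp only [Finset.mem_filter, Finset.mem_compl] at hv hw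
      exact hv.2 ((hc v w hv.1 hw.1 hadj).trans hw.2)
  · exfalso
    have hsδ : (δ : ℝ) + 1 ≤ s := by rw [hs]; exact_mod_cast hgt
    have hN' : (Fintype.card V : ℝ) = (N - (s - δ))
        + (Fintype.card (Fin (S.card - k + 2)) - 1) * 1 := by
      rw [hcard, hVn, hNdef]
      ring
    have hj : 2 * (s - δ) + δ + 1 ≤ N := by
      have := (hone 0).trans (card_class_add_le_extreme hone hN' 0)
      linarith
    have hl' : θ + 2 * (s - δ) + 2 * ((N - (s - δ)) - 1) = l := by
      rw [hlN]; ring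
    have := signlessRadius_lt_of_quotient G S c hc (θ := θ + 2 * (s - δ))
      zero_le_one (by linarith) hone hN'
    rw [hl', hcard] at this
    refine (this (by linarith) ?_).not_ge hq
    have := quotient_ineq_large (N := N) (δ := δ) (d := δ - k + 1) (j := s - δ) hθ0
      (by linarith) (by linarith) (by linarith) (by linarith) (by linarith) hj
      (by rw [← hlN]; linear_combination hl)
    rw [← hlN] at this
    linarith

theorem theorem2 {V : Type*} [Fintype V] (G : SimpleGraph V) [DecidableRel G.Adj]
    (n δ k : ℕ) (hn : Fintype.card V = n) (hδ : G.minDegree = δ)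
    (hnδ : 9 * (δ : ℤ) - 2 * (k : ℤ) + 12 ≤ (n : ℤ))
    (hk : k < δ) (hpar : k ≡ n [MOD 2]) :
    (signlessRadius (extremalGraph n δ k) ≤ signlessRadius G →
      (IsFactorCritical G k ↔ ¬ Nonempty (G ≃g extremalGraph n δ k))) ∧
    IsGreatest {x : ℝ | extremalCubic n δ k x = 0}
      (signlessRadius (extremalGraph n δ k)) := by
  refine ⟨fun hq => ⟨?_, fun h => ?_⟩, (signlessRadius_extremalGraph hk hnδ).1⟩
  · rintro h ⟨e⟩
    exact not_isFactorCritical_of_iso_extremalGraph hk e h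
  · by_contra hfc
    exact h (nonempty_iso_of_not_isFactorCritical G n δ k hn hδ hnδ hk hpar hq hfc)
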